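/- Let $H$ be a separable infinite-dimensional complex Hilbert space and let $T$ be a bounded linear operator on $H$. Write $N(T)$ and $R(T)$ for the kernel and range of $T$, and put $\alpha(T)=\dim N(T)$, $\beta(T)=\dim H/R(T)$, with values in $\{0,1,2,\dots,\infty\}$. The ascent $\mathrm{asc}(T)$ is the smallest integer $k\ge 0$ with $N(T^k)=N(T^{k+1})$, and the descent $\mathrm{des}(T)$ is the smallest integer $k\ge 0$ with $R(T^k)=R(T^{k+1})$; each is $\infty$ if no such $k$ exists. $T$ is upper semi-Fredholm if $R(T)$ is closed and $\alpha(T)<\infty$, lower semi-Fredholm if $\beta(T)<\infty$ (which implies that $R(T)$ is closed), semi-Fredholm if it is upper or lower semi-Fredholm, and Fredholm if $\alpha(T)<\infty$ and $\beta(T)<\infty$. $T$ is upper semi-Browder if it is upper semi-Fredholm and $\mathrm{asc}(T)<\infty$, lower semi-Browder if it is lower semi-Fredholm and $\mathrm{des}(T)<\infty$, and Browder if it is Fredholm and $\mathrm{asc}(T)=\mathrm{des}(T)<\infty$. For semi-Fredholm $T$ the shift and backward shift Samuel multiplicities are $$s\_mul(T)=\lim_{k\to\infty}\frac{\beta(T^k)}{k},\qquad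 b.s\_mul(T)=\lim_{k\to\infty}\frac{\alpha(T^k)}{k}\qquad\text{in } [0,\infty].$$ A semi-Fredholm operator $T$ is called shift-like if $b.s\_mul(T)=0$, backward shift-like if $s\_mul(T)=0$, and stationary if $b.s\_mul(T)=s\_mul(T)=0$. Then: (1) $T$ is a shift-like semi-Fredholm operator if and only if $T$ is upper semi-Browder; (2) $T$ is a backward shift-like semi-Fredholm operator if and only if $T$ is lower semi-Browder; (3) $T$ is a stationary semi-Fredholm operator if and only if $T$ is Browder. -/

import Mathlib

open scoped Topology ENNReal

namespace SemiFredholm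

noncomputable section

variable {H : Type*} [NormedAddCommGroup H] [InnerProductSpace ℂ H]

/-- `α(T) = dim N(T)`, with value `∞` if the kernel is infinite dimensional. -/
def nullity (T : H →L[ℂ] H) : ℕ∞ :=
  Cardinal.toENat (Module.rank ℂ T.ker)

/-- `β(T) = dim H / R(T)`, the (algebraic) codimension of the range,
with value `∞` if it is infinite. -/
def defect (T : H →L[ℂ] H) : ℕ∞ :=
  Cardinal.toENat (Module.rank ℂ (H ⧸ T.range))

/-- The ascent: the smallest `k ≥ 0` with `N(T ^ k) = N(T ^ (k + 1))`, and `∞` if there is none. -/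
def ascent (T : H →L[ℂ] H) : ℕ∞ :=
  sInf {k : ℕ∞ | ∃ n : ℕ, k = n ∧ (T ^ n).ker = (T ^ (n + 1)).ker}

/-- The descent: the smallest `k ≥ 0` with `R(T ^ k) = R(T ^ (k + 1))`, and `∞` if there is none. -/
def descent (T : H →L[ℂ] H) : ℕ∞ :=
  sInf {k : ℕ∞ | ∃ n : ℕ, k = n ∧ (T ^ n).range = (T ^ (n + 1)).range}

/-- Upper semi-Fredholm: closed range and finite dimensional kernel. -/
def IsUpperSemiFredholm (T : H →L[ℂ] H) : Prop :=
  IsClosed (T.range : Set H) ∧ nullity T < ⊤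

/-- Lower semi-Fredholm: range of finite codimension. -/
def IsLowerSemiFredholm (T : H →L[ℂ] H) : Prop :=
  defect T < ⊤

/-- Semi-Fredholm: upper or lower semi-Fredholm. -/
def IsSemiFredholm (T : H →L[ℂ] H) : Prop :=
  IsUpperSemiFredholm T ∨ IsLowerSemiFredholm T

/-- Upper semi-Browder: upper semi-Fredholm with finite ascent. -/
def IsUpperSemiBrowder (T : H →L[ℂ] H) : Prop :=
  IsUpperSemiFredholm T ∧ ascent T < ⊤

/-- Lower semi-Browder: lower semi-Fredholm with finite descent. -/
def IsLowerSemiBrowder (T : H →L[ℂ] H) : Prop :=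
  IsLowerSemiFredholm T ∧ descent T < ⊤

/-- Browder: Fredholm with `asc(T) = des(T) < ∞`. On a Hilbert space, Mathlib's notion of Fredholm
operator is the same as `α(T) < ∞` and `β(T) < ∞`, see `isFredholm_iff` below. -/
def IsBrowder (T : H →L[ℂ] H) : Prop :=
  T.IsFredholm ∧ ascent T = descent T ∧ descent T < ⊤

/-- The shift Samuel multiplicity `lim β(T ^ k) / k`, in `[0, ∞]`. The limit always exists,
see `tendsto_shiftMul` below. -/
def shiftMul (T : H →L[ℂ] H) : ℝ≥0∞ :=
  Filter.atTop.limUnder fun k : ℕ => (defect (T ^ k) : ℝ≥0∞) / (k : ℝ≥0∞)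

/-- The backward shift Samuel multiplicity `lim α(T ^ k) / k`, in `[0, ∞]`. The limit always exists,
see `tendsto_backwardShiftMul` below. -/
def backwardShiftMul (T : H →L[ℂ] H) : ℝ≥0∞ :=
  Filter.atTop.limUnder fun k : ℕ => (nullity (T ^ k) : ℝ≥0∞) / (k : ℝ≥0∞)

/-- Shift-like semi-Fredholm: semi-Fredholm with vanishing backward shift multiplicity. -/
def IsShiftLike (T : H →L[ℂ] H) : Prop :=
  IsSemiFredholm T ∧ backwardShiftMul T = 0

/-- Backward shift-like semi-Fredholm: semi-Fredholm with vanishing shift multiplicity. -/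
def IsBackwardShiftLike (T : H →L[ℂ] H) : Prop :=
  IsSemiFredholm T ∧ shiftMul T = 0

/-- Stationary semi-Fredholm: semi-Fredholm, and both multiplicities vanish. -/
def IsStationary (T : H →L[ℂ] H) : Prop :=
  IsSemiFredholm T ∧ backwardShiftMul T = 0 ∧ shiftMul T = 0

/-- Subadditive sequences in `ℕ∞` have a limit after division by the index (the value at index
zero is irrelevant for the limit). -/
theorem exists_tendsto_div (u : ℕ → ℕ∞) (hu0 : u 0 ≠ ⊤) (hu : ∀ m n, u (m + n) ≤ u m + u n)
    (hmono : Monotone u) :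
    ∃ l : ℝ≥0∞, Filter.Tendsto (fun k : ℕ => (u k : ℝ≥0∞) / (k : ℝ≥0∞)) Filter.atTop (𝓝 l) := by
  by_cases h1 : u 1 = ⊤
  · refine ⟨⊤, tendsto_const_nhds.congr' ?_⟩
    filter_upwards [Filter.eventually_ge_atTop 1] with k hk
    have : u k = ⊤ := top_le_iff.1 (h1 ▸ hmono hk)
    simp [this, ENNReal.top_div]
  · have hfin : ∀ k, u k ≠ ⊤ := by
      intro k
      induction k with
      | zero => exact hu0
      | succ k ih => exact ne_top_of_le_ne_top (WithTop.add_ne_top.2 ⟨ih, h1⟩) (hu k 1)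
    choose v hv using fun k => ENat.ne_top_iff_exists.1 (hfin k)
    have hsub : Subadditive (fun k => (v k : ℝ)) := by
      intro m n
      have := hu m n
      rw [← hv, ← hv, ← hv] at this
      have h' : v (m + n) ≤ v m + v n := by exact_mod_cast this
      change (v (m + n) : ℝ) ≤ v m + v n
      exact_mod_cast h'
    have hlim := hsub.tendsto_lim ⟨0, by rintro _ ⟨n, rfl⟩; positivity⟩
    refine ⟨ENNReal.ofReal hsub.lim, ?_⟩
    refine ((ENNReal.continuous_ofReal.tendsto _).comp hlim).congr' ?_
    filter_upwards [Filter.eventually_gt_atTop 0] with k hk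
    have hk' : (0 : ℝ) < k := by exact_mod_cast hk
    simp only [Function.comp_apply]
    rw [ENNReal.ofReal_div_of_pos hk', ← hv k]
    simp

theorem nullity_mul_le (S T : H →L[ℂ] H) : nullity (S * T) ≤ nullity S + nullity T := by
  have h := LinearMap.lift_rank_comap_le (f := (T : H →ₗ[ℂ] H)) (S : H →ₗ[ℂ] H).ker
  simp only [Cardinal.lift_id] at h
  rw [nullity, nullity, nullity, ← map_add]
  exact OrderHomClass.mono _ h

theorem defect_mul_le (S T : H →L[ℂ] H) : defect (S * T) ≤ defect S + defect T := by
  have h := LinearMap.lift_rank_quot_map_le (f := (S : H →ₗ[ℂ] H)) (T : H →ₗ[ℂ] H).range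
  simp only [Cardinal.lift_id] at h
  have e : ((S * T : H →L[ℂ] H) : H →ₗ[ℂ] H).range
      = (T : H →ₗ[ℂ] H).range.map (S : H →ₗ[ℂ] H) := by
    rw [← LinearMap.range_comp]; rfl
  rw [defect, defect, defect, e, ← map_add]
  exact OrderHomClass.mono _ h

theorem nullity_pow_mono (T : H →L[ℂ] H) : Monotone fun k : ℕ => nullity (T ^ k) := by
  refine monotone_nat_of_le_succ fun k => OrderHomClass.mono _ (Submodule.rank_mono ?_)
  intro x hx
  have hx' : (T ^ k) x = 0 := hx
  change (T ^ (k + 1)) x = 0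
  rw [pow_succ']
  simp [hx']

theorem defect_pow_mono (T : H →L[ℂ] H) : Monotone fun k : ℕ => defect (T ^ k) := by
  refine monotone_nat_of_le_succ fun k => OrderHomClass.mono _ ?_
  have hle : (T ^ (k + 1)).range ≤ (T ^ k).range := by
    rintro _ ⟨x, rfl⟩
    exact ⟨T x, by simp [pow_succ]⟩
  exact (Submodule.factor hle).rank_le_of_surjective (Submodule.factor_surjective hle)

/-- The limit in the definition of `shiftMul` exists. -/
theorem tendsto_shiftMul (T : H →L[ℂ] H) :
    Filter.Tendsto (fun k : ℕ => (defect (T ^ k) : ℝ≥0∞) / (k : ℝ≥0∞)) Filter.atTop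
      (𝓝 (shiftMul T)) :=
  tendsto_nhds_limUnder (exists_tendsto_div (fun k => defect (T ^ k))
    (by
      have : Subsingleton (H ⧸ (T ^ 0).range) := by
        rw [Submodule.Quotient.subsingleton_iff, eq_top_iff]
        exact fun x _ => ⟨x, by simp⟩
      simp [defect])
    (fun m n => by rw [pow_add]; exact defect_mul_le _ _) (defect_pow_mono T))

/-- The limit in the definition of `backwardShiftMul` exists. -/
theorem tendsto_backwardShiftMul (T : H →L[ℂ] H) :
    Filter.Tendsto (fun k : ℕ => (nullity (T ^ k) : ℝ≥0∞) / (k : ℝ≥0∞)) Filter.atTop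
      (𝓝 (backwardShiftMul T)) :=
  tendsto_nhds_limUnder (exists_tendsto_div (fun k => nullity (T ^ k))
    (by
      have : (T ^ 0).ker = ⊥ := by
        rw [eq_bot_iff]
        intro x hx
        have hx' : (T ^ 0) x = 0 := hx
        simpa using hx'
      rw [nullity, this]
      simp)
    (fun m n => by rw [pow_add]; exact nullity_mul_le _ _) (nullity_pow_mono T))

theorem nullity_lt_top_iff (T : H →L[ℂ] H) : nullity T < ⊤ ↔ FiniteDimensional ℂ T.ker := by
  rw [nullity, Cardinal.toENat_lt_top, Module.rank_lt_aleph0_iff]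

theorem defect_lt_top_iff (T : H →L[ℂ] H) :
    defect T < ⊤ ↔ FiniteDimensional ℂ (H ⧸ T.range) := by
  rw [defect, Cardinal.toENat_lt_top, Module.rank_lt_aleph0_iff]

/-- On a Hilbert space, Mathlib's Fredholm operators are exactly the operators with
`α(T) < ∞` and `β(T) < ∞`. -/
theorem isFredholm_iff [CompleteSpace H] (T : H →L[ℂ] H) :
    T.IsFredholm ↔ nullity T < ⊤ ∧ defect T < ⊤ := by
  rw [nullity_lt_top_iff, defect_lt_top_iff]
  constructor
  · intro h
    exact ⟨h.finite_ker, h.finite_coker⟩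
  · rintro ⟨h1, h2⟩
    obtain ⟨G, hG⟩ := T.range.exists_isCompl
    have hGfin : FiniteDimensional ℂ G :=
      (Submodule.quotientEquivOfIsCompl T.range G hG).finiteDimensional
    have hGcl : IsClosed (G : Set H) := G.closed_of_finiteDimensional
    have hGc : G.ClosedComplemented := .of_finiteDimensional G
    have hsurj : Function.Surjective (G.mkQL ∘L T) := by
      intro y
      obtain ⟨x, rfl⟩ := G.mkQ_surjective y
      have hx : x ∈ T.range ⊔ G := by rw [hG.sup_eq_top]; trivial
      obtain ⟨_, ⟨z, rfl⟩, g, hg, rfl⟩ := Submodule.mem_sup.1 hx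
      refine ⟨z, ?_⟩
      simp [hg]
    have hrange : ((G.mkQL ∘L T).range : Set (H ⧸ G)) = Set.univ := by
      rw [LinearMap.range_eq_top.2 hsurj]; rfl
    have key := (T.isStrictMap_isClosed_range_iff_quotient G hGc).2
      ⟨((G.mkQL ∘L T).isQuotientMap hsurj).isStrictMap, by rw [hrange]; exact isClosed_univ⟩
    exact ⟨key.1, key.2, h1, h2, .of_finiteDimensional _⟩

end

end SemiFredholm

/-! ### Limits of normalised dimension sequences -/

namespace SemiFredholm

open Filter

/-! Everything rests on a dichotomy for the nondecreasing sequence `α(T ^ k)`. If `α(T) = ∞`, or if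
the kernels never stabilise, then `α(T ^ k) ≥ k` for `k ≥ 1` and the limit of `α(T ^ k) / k` is at
least `1`; if `α(T)` and the ascent are finite, the sequence is bounded and the limit is `0`. The
same holds for `β`, ranges and descent (`backwardShiftMul_eq_zero_iff`, `shiftMul_eq_zero_iff`). Two
facts remain: a semi-Fredholm operator with finite nullity has closed range
(`isUpperSemiFredholm_iff_nullity_lt_top`), and ascent and descent agree once both are finite, by
pure algebra (`ascent_eq_descent`). -/

theorem ne_zero_of_tendsto_div {u : ℕ → ℕ∞} {l : ℝ≥0∞}
    (h : Tendsto (fun k : ℕ => (u k : ℝ≥0∞) / (k : ℝ≥0∞)) atTop (𝓝 l))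
    (hu : ∀ k : ℕ, 1 ≤ k → (k : ℕ∞) ≤ u k) : l ≠ 0 := by
  have h1 : 1 ≤ l := by
    refine ge_of_tendsto h ?_
    filter_upwards [eventually_ge_atTop 1] with k hk
    have hk0 : (k : ℝ≥0∞) ≠ 0 := by exact_mod_cast (by omega : k ≠ 0)
    rw [ENNReal.le_div_iff_mul_le (.inl hk0) (.inl (ENNReal.natCast_ne_top k)), one_mul]
    exact_mod_cast ENat.toENNReal_le.2 (hu k hk)
  exact (zero_lt_one.trans_le h1).ne'

theorem eq_zero_of_tendsto_div {u : ℕ → ℕ∞} {l : ℝ≥0∞} {c : ℕ∞}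
    (h : Tendsto (fun k : ℕ => (u k : ℝ≥0∞) / (k : ℝ≥0∞)) atTop (𝓝 l))
    (hc : c ≠ ⊤) (hu : ∀ k, u k ≤ c) : l = 0 := by
  have hc' : (c : ℝ≥0∞) ≠ ⊤ := by simpa using hc
  have h0 : Tendsto (fun k : ℕ => (c : ℝ≥0∞) / (k : ℝ≥0∞)) atTop (𝓝 0) := by
    simpa using ENNReal.Tendsto.const_div ENNReal.tendsto_nat_nhds_top (.inr hc')
  exact tendsto_nhds_unique h (tendsto_of_tendsto_of_tendsto_of_le_of_le tendsto_const_nhds h0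
    (fun _ => zero_le) fun k => ENNReal.div_le_div_right (ENat.toENNReal_le.2 (hu k)) _)

/-- Strict growth is required only at finite values, since equal infinite dimensions do not force
nested subspaces to coincide. -/
theorem natCast_le_of_lt_succ {u : ℕ → ℕ∞} (hmono : Monotone u)
    (hu : ∀ k, u (k + 1) ≠ ⊤ → u k ≠ u (k + 1)) (k : ℕ) : (k : ℕ∞) ≤ u k := by
  induction k with
  | zero => simp
  | succ k ih =>
    by_cases htop : u (k + 1) = ⊤
    · simp [htop]
    · have hlt : u k < u (k + 1) := (hmono k.le_succ).lt_of_ne (hu k htop)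
      push_cast
      exact (add_le_add_left ih 1).trans (Order.add_one_le_of_lt hlt)

variable {H : Type*} [NormedAddCommGroup H] [InnerProductSpace ℂ H]

/-! ### Stabilisation of kernels and ranges of powers -/

theorem ascent_lt_top_iff (T : H →L[ℂ] H) :
    ascent T < ⊤ ↔ ∃ n : ℕ, (T ^ n).ker = (T ^ (n + 1)).ker := by
  rw [ascent, sInf_lt_iff]
  constructor
  · rintro ⟨_, ⟨n, -, hn⟩, -⟩
    exact ⟨n, hn⟩
  · rintro ⟨n, hn⟩
    exact ⟨n, ⟨n, rfl, hn⟩, ENat.natCast_lt_top n⟩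

theorem descent_lt_top_iff (T : H →L[ℂ] H) :
    descent T < ⊤ ↔ ∃ n : ℕ, (T ^ n).range = (T ^ (n + 1)).range := by
  rw [descent, sInf_lt_iff]
  constructor
  · rintro ⟨_, ⟨n, -, hn⟩, -⟩
    exact ⟨n, hn⟩
  · rintro ⟨n, hn⟩
    exact ⟨n, ⟨n, rfl, hn⟩, ENat.natCast_lt_top n⟩

theorem ker_pow_le_succ (T : H →L[ℂ] H) (k : ℕ) : (T ^ k).ker ≤ (T ^ (k + 1)).ker := by
  intro x hx
  have hx' : (T ^ k) x = 0 := hx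
  change (T ^ (k + 1)) x = 0
  simp [pow_succ', hx']

theorem range_pow_succ_le (T : H →L[ℂ] H) (k : ℕ) : (T ^ (k + 1)).range ≤ (T ^ k).range := by
  rintro _ ⟨x, rfl⟩
  exact ⟨T x, by simp [pow_succ]⟩

theorem ker_pow_eq_of_le {T : H →L[ℂ] H} {n : ℕ} (h : (T ^ n).ker = (T ^ (n + 1)).ker)
    {m : ℕ} (hm : n ≤ m) : (T ^ m).ker = (T ^ n).ker := by
  induction m, hm using Nat.le_induction with
  | base => rfl
  | succ m hm ih =>
    refine le_antisymm (fun x hx => ?_) (ih ▸ ker_pow_le_succ T m)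
    have hx' : (T ^ (m + 1)) x = 0 := hx
    have hTx : T x ∈ (T ^ n).ker := by
      rw [← ih]
      change (T ^ m) (T x) = 0
      simpa [pow_succ] using hx'
    rw [h]
    have hTx' : (T ^ n) (T x) = 0 := hTx
    change (T ^ (n + 1)) x = 0
    simpa [pow_succ] using hTx'

theorem range_pow_eq_of_le {T : H →L[ℂ] H} {n : ℕ} (h : (T ^ n).range = (T ^ (n + 1)).range)
    {m : ℕ} (hm : n ≤ m) : (T ^ m).range = (T ^ n).range := by
  induction m, hm using Nat.le_induction with
  | base => rfl
  | succ m hm ih =>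
    refine le_antisymm (ih ▸ range_pow_succ_le T m) ?_
    rw [h]
    rintro _ ⟨x, rfl⟩
    obtain ⟨y, hy⟩ : (T ^ n) x ∈ (T ^ m).range := ih ▸ ⟨x, rfl⟩
    have hy' : (T ^ m) y = (T ^ n) x := hy
    refine ⟨y, ?_⟩
    change (T ^ (m + 1)) y = (T ^ (n + 1)) x
    rw [pow_succ', mul_apply_eq_comp, hy', ← mul_apply_eq_comp, ← pow_succ']

/-- Stable ranges give `T ^ (p + q) x = T ^ (p + q + 1) z`, so `T z - x` lies in `N(T ^ (p + q)) =
N(T ^ p)`; now apply `T ^ p`. -/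
theorem range_pow_eq_succ_of_ker {T : H →L[ℂ] H} {p q : ℕ}
    (hp : (T ^ p).ker = (T ^ (p + 1)).ker) (hq : (T ^ q).range = (T ^ (q + 1)).range) :
    (T ^ p).range = (T ^ (p + 1)).range := by
  refine le_antisymm ?_ (range_pow_succ_le T p)
  rintro _ ⟨x, rfl⟩
  obtain ⟨z, hz⟩ : (T ^ (p + q)) x ∈ (T ^ (p + q + 1)).range := by
    rw [range_pow_eq_of_le hq (by omega), ← range_pow_eq_of_le hq (by omega : q ≤ p + q)]
    exact ⟨x, rfl⟩
  have hz' : (T ^ (p + q + 1)) z = (T ^ (p + q)) x := hz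
  have hmem : T z - x ∈ (T ^ p).ker := by
    rw [← ker_pow_eq_of_le hp (Nat.le_add_right p q)]
    change (T ^ (p + q)) (T z - x) = 0
    rw [map_sub, ← hz', pow_succ]
    simp
  have hmem' : (T ^ p) (T z - x) = 0 := hmem
  rw [map_sub, sub_eq_zero] at hmem'
  refine ⟨z, ?_⟩
  change (T ^ (p + 1)) z = (T ^ p) x
  rw [pow_succ, mul_apply_eq_comp, hmem']

/-- If `T ^ (q + 1) x = 0`, write `T ^ q x = T ^ (p + q) z`. Then `T ^ (p + q + 1) z = 0`, and
stable kernels already give `T ^ (p + q) z = 0`. -/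
theorem ker_pow_eq_succ_of_range {T : H →L[ℂ] H} {p q : ℕ}
    (hp : (T ^ p).ker = (T ^ (p + 1)).ker) (hq : (T ^ q).range = (T ^ (q + 1)).range) :
    (T ^ q).ker = (T ^ (q + 1)).ker := by
  refine le_antisymm (ker_pow_le_succ T q) fun x hx => ?_
  have hx' : (T ^ (q + 1)) x = 0 := hx
  obtain ⟨z, hz⟩ : (T ^ q) x ∈ (T ^ (p + q)).range := by
    rw [range_pow_eq_of_le hq (by omega)]
    exact ⟨x, rfl⟩
  have hz' : (T ^ (p + q)) z = (T ^ q) x := hz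
  have hmem : z ∈ (T ^ (p + q)).ker := by
    rw [ker_pow_eq_of_le hp (by omega), ← ker_pow_eq_of_le hp (by omega : p ≤ p + q + 1)]
    change (T ^ (p + q + 1)) z = 0
    rw [pow_succ', mul_apply_eq_comp, hz', ← mul_apply_eq_comp,
      ← pow_succ', hx']
  change (T ^ q) x = 0
  rw [← hz']
  exact hmem

theorem ascent_eq_descent {T : H →L[ℂ] H} (ha : ascent T < ⊤) (hd : descent T < ⊤) :
    ascent T = descent T := by
  obtain ⟨p, hp⟩ := (ascent_lt_top_iff T).1 ha
  obtain ⟨q, hq⟩ := (descent_lt_top_iff T).1 hd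
  -- Kernels and ranges stabilise at the same indices, so both infima run over the same set.
  have h (n : ℕ) : (T ^ n).ker = (T ^ (n + 1)).ker ↔ (T ^ n).range = (T ^ (n + 1)).range :=
    ⟨fun h => range_pow_eq_succ_of_ker h hq, fun h => ker_pow_eq_succ_of_range hp h⟩
  simp only [ascent, descent, h]

/-! ### Comparing subspaces through finite dimensions -/

theorem ker_eq_of_nullity_eq {S T : H →L[ℂ] H} (hle : S.ker ≤ T.ker) (hT : nullity T ≠ ⊤)
    (h : nullity S = nullity T) : S.ker = T.ker := by
  have hTfin := (nullity_lt_top_iff T).1 hT.lt_top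
  have hSfin := (nullity_lt_top_iff S).1 (h ▸ hT.lt_top)
  refine Submodule.eq_of_le_of_finrank_eq hle ?_
  rw [nullity, nullity, ← Module.finrank_eq_rank, ← Module.finrank_eq_rank, Cardinal.toENat_nat,
    Cardinal.toENat_nat] at h
  exact_mod_cast h

theorem range_eq_of_defect_eq {S T : H →L[ℂ] H} (hle : T.range ≤ S.range) (hT : defect T ≠ ⊤)
    (h : defect S = defect T) : S.range = T.range := by
  have hTfin := (defect_lt_top_iff T).1 hT.lt_top
  have hSfin := (defect_lt_top_iff S).1 (h ▸ hT.lt_top)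
  rw [defect, defect, ← Module.finrank_eq_rank, ← Module.finrank_eq_rank, Cardinal.toENat_nat,
    Cardinal.toENat_nat] at h
  have hfr : Module.finrank ℂ (H ⧸ T.range) = Module.finrank ℂ (H ⧸ S.range) := by
    exact_mod_cast h.symm
  -- The canonical surjection `H / R(T) → H / R(S)` between spaces of equal finite dimension is
  -- injective.
  have hinj := (LinearMap.injective_iff_surjective_of_finrank_eq_finrank hfr).2
    (Submodule.factor_surjective hle)
  refine le_antisymm (fun x hx => ?_) hle
  rw [← Submodule.Quotient.mk_eq_zero]
  apply hinj
  rw [map_zero]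
  exact (Submodule.Quotient.mk_eq_zero _).2 hx

theorem nullity_pow_lt_top {T : H →L[ℂ] H} (hT : nullity T < ⊤) (k : ℕ) :
    nullity (T ^ k) < ⊤ := by
  induction k with
  | zero =>
    have : (T ^ 0).ker = ⊥ := (Submodule.eq_bot_iff _).2 fun x hx => by
      simpa using (show (T ^ 0) x = 0 from hx)
    rw [nullity, this]
    simp
  | succ k ih =>
    rw [pow_succ]
    exact (nullity_mul_le _ _).trans_lt (WithTop.add_lt_top.2 ⟨ih, hT⟩)

theorem defect_pow_lt_top {T : H →L[ℂ] H} (hT : defect T < ⊤) (k : ℕ) :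
    defect (T ^ k) < ⊤ := by
  induction k with
  | zero =>
    have : Subsingleton (H ⧸ (T ^ 0).range) := by
      rw [Submodule.Quotient.subsingleton_iff, eq_top_iff]
      exact fun x _ => ⟨x, by simp⟩
    simp [defect]
  | succ k ih =>
    rw [pow_succ]
    exact (defect_mul_le _ _).trans_lt (WithTop.add_lt_top.2 ⟨ih, hT⟩)

/-! ### Vanishing of the multiplicities -/

/-- The backward shift multiplicity vanishes exactly for finite nullity and finite ascent. -/
theorem backwardShiftMul_eq_zero_iff (T : H →L[ℂ] H) :
    backwardShiftMul T = 0 ↔ nullity T < ⊤ ∧ ascent T < ⊤ := by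
  have hlim := tendsto_backwardShiftMul T
  constructor
  · intro h
    constructor
    · by_contra hT
      refine ne_zero_of_tendsto_div hlim (fun k hk => ?_) h
      have h1 : nullity (T ^ 1) ≤ nullity (T ^ k) := nullity_pow_mono T hk
      rw [pow_one, not_lt_top_iff.1 hT] at h1
      simp [top_le_iff.1 h1]
    · by_contra hT
      rw [ascent_lt_top_iff, not_exists] at hT
      exact ne_zero_of_tendsto_div hlim (fun k _ => natCast_le_of_lt_succ (nullity_pow_mono T)
        (fun (n : ℕ) hn he => hT n (ker_eq_of_nullity_eq (ker_pow_le_succ T n) hn he)) k) h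
  · rintro ⟨hT, ha⟩
    obtain ⟨p, hp⟩ := (ascent_lt_top_iff T).1 ha
    refine eq_zero_of_tendsto_div hlim (nullity_pow_lt_top hT p).ne fun k => ?_
    -- Passing to `max k p` gives the bound `α(T ^ p)` for all `k`, including `k < p`.
    refine (nullity_pow_mono T (le_max_left k p)).trans_eq ?_
    change nullity (T ^ max k p) = nullity (T ^ p)
    rw [nullity, nullity, ker_pow_eq_of_le hp (le_max_right k p)]

/-- The shift multiplicity vanishes exactly for finite defect and finite descent. -/
theorem shiftMul_eq_zero_iff (T : H →L[ℂ] H) :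
    shiftMul T = 0 ↔ defect T < ⊤ ∧ descent T < ⊤ := by
  have hlim := tendsto_shiftMul T
  constructor
  · intro h
    constructor
    · by_contra hT
      refine ne_zero_of_tendsto_div hlim (fun k hk => ?_) h
      have h1 : defect (T ^ 1) ≤ defect (T ^ k) := defect_pow_mono T hk
      rw [pow_one, not_lt_top_iff.1 hT] at h1
      simp [top_le_iff.1 h1]
    · by_contra hT
      rw [descent_lt_top_iff, not_exists] at hT
      exact ne_zero_of_tendsto_div hlim (fun k _ => natCast_le_of_lt_succ (defect_pow_mono T)
        (fun (n : ℕ) hn he => hT n (range_eq_of_defect_eq (range_pow_succ_le T n) hn he)) k) h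
  · rintro ⟨hT, hd⟩
    obtain ⟨q, hq⟩ := (descent_lt_top_iff T).1 hd
    refine eq_zero_of_tendsto_div hlim (defect_pow_lt_top hT q).ne fun k => ?_
    refine (defect_pow_mono T (le_max_left k q)).trans_eq ?_
    change defect (T ^ max k q) = defect (T ^ q)
    rw [defect, defect, range_pow_eq_of_le hq (le_max_right k q)]

/-- In the lower semi-Fredholm case, finite nullity makes `T` Fredholm, which gives the closed
range. -/
theorem isUpperSemiFredholm_iff_nullity_lt_top [CompleteSpace H] {T : H →L[ℂ] H}
    (hT : IsSemiFredholm T) : IsUpperSemiFredholm T ↔ nullity T < ⊤ := by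
  refine ⟨fun h => h.2, fun h => hT.elim id fun hl => ⟨?_, h⟩⟩
  exact ((isFredholm_iff T).2 ⟨h, hl⟩).isClosed_range

end SemiFredholm

theorem theorem1p9 {H : Type*} [NormedAddCommGroup H] [InnerProductSpace ℂ H] [CompleteSpace H]
    [TopologicalSpace.SeparableSpace H] (hH : ¬ FiniteDimensional ℂ H) (T : H →L[ℂ] H) :
    (SemiFredholm.IsShiftLike T ↔ SemiFredholm.IsUpperSemiBrowder T) ∧
    (SemiFredholm.IsBackwardShiftLike T ↔ SemiFredholm.IsLowerSemiBrowder T) ∧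
    (SemiFredholm.IsStationary T ↔ SemiFredholm.IsBrowder T) := by
  open SemiFredholm in
  refine ⟨⟨?_, ?_⟩, ⟨?_, ?_⟩, ⟨?_, ?_⟩⟩
  · rintro ⟨hT, h⟩
    rw [backwardShiftMul_eq_zero_iff] at h
    exact ⟨(isUpperSemiFredholm_iff_nullity_lt_top hT).2 h.1, h.2⟩
  · rintro ⟨hT, h⟩
    exact ⟨.inl hT, (backwardShiftMul_eq_zero_iff T).2 ⟨hT.2, h⟩⟩
  · rintro ⟨-, h⟩
    exact (shiftMul_eq_zero_iff T).1 h
  · rintro ⟨hT, h⟩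
    exact ⟨.inr hT, (shiftMul_eq_zero_iff T).2 ⟨hT, h⟩⟩
  · rintro ⟨-, hb, hs⟩
    rw [backwardShiftMul_eq_zero_iff] at hb
    rw [shiftMul_eq_zero_iff] at hs
    exact ⟨(isFredholm_iff T).2 ⟨hb.1, hs.1⟩, ascent_eq_descent hb.2 hs.2, hs.2⟩
  · rintro ⟨hT, he, hd⟩
    obtain ⟨hn, hf⟩ := (isFredholm_iff T).1 hT
    exact ⟨.inr hf, (backwardShiftMul_eq_zero_iff T).2 ⟨hn, he ▸ hd⟩,
      (shiftMul_eq_zero_iff T).2 ⟨hf, hd⟩⟩
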